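/- Let $p,q$ be integers with $q\ge 1$ and $p\ge 2q+3$. For $M\in\mathbb{R}^{p\times q}$ let $Y\sim \mathrm{N}_{p,q}(M,I_p,I_q)$, i.e. the entries $Y_{ij}$ are independent with $Y_{ij}\sim \mathrm{N}(M_{ij},1)$. Consider the estimator $\hat M(Y)=Y$ of $M$ under the Frobenius loss $\|\hat M-M\|_{\mathrm F}^2=\sum_{i,j}(\hat M_{ij}-M_{ij})^2$. A loss estimator is a measurable function $\lambda:\mathbb{R}^{p\times q}\to\mathbb{R}$, and its mean squared error at $M$ is $\mathrm{E}_M[(\lambda(Y)-\|\hat M(Y)-M\|_{\mathrm F}^2)^2]\in[0,\infty]$. One loss estimator dominates another if its mean squared error is at most that of the other for every $M$, with strict inequality for at least one $M$; a loss estimator is inadmissible if some loss estimator dominates it. Stein's unbiased risk estimate (SURE) of an estimator $\hat M(Y)=Y+g(Y)$ is $\lambda^{\mathrm U}(Y)=pq+2\sum_{i,j}\frac{\partial g_{ij}}{\partial Y_{ij}}(Y)+\|g(Y)\|_{\mathrm F}^2$. Then, for $\hat M(Y)=Y$, SURE is the constant $\lambda^{\mathrm U}(Y)=pq$, it is inadmissible,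 and it is dominated by the loss estimator $$\lambda(Y)=pq-\frac{2(p-2q-2)}{q}\,\mathrm{tr}\big((Y^{\top}Y)^{-1}\big).$$ Here $\lambda$ is measurable (with the convention that the inverse of a singular matrix is $0$), and $Y^{\top}Y$ is invertible almost surely for every $M$. The domination is strict everywhere: $$\mathrm{E}_M\big[(\lambda(Y)-\|Y-M\|_{\mathrm F}^2)^2\big]<\mathrm{E}_M\big[(\lambda^{\mathrm U}(Y)-\|Y-M\|_{\mathrm F}^2)^2\big]\quad\text{for every } M\in\mathbb{R}^{p\times q}.$$ -/

import Mathlib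

open MeasureTheory ProbabilityTheory
open scoped ENNReal Matrix

namespace LossEstimation

/-! ### The general loss estimation framework -/

section General

/-- Mean squared error `E_θ[(lam(y) - L(θ, δ(y)))²]` of the loss estimator `lam` as an estimator of
the loss `L(θ, δ(y))` of the point estimator `δ`, under the model `y ∼ P θ`.
It is the integral of a nonnegative function, valued in `[0, ∞]`. -/
noncomputable def lossMSE {Θ 𝒴 : Type*} [MeasurableSpace 𝒴] (P : Θ → Measure 𝒴)
    (L : Θ → Θ → ℝ) (δ : 𝒴 → Θ) (lam : 𝒴 → ℝ) (θ : Θ) : ℝ≥0∞ :=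
  ∫⁻ y, ENNReal.ofReal ((lam y - L θ (δ y)) ^ 2) ∂(P θ)

/-- `lam₁` dominates `lam₂`: its mean squared error is at most that of `lam₂` for every parameter,
with strict inequality for at least one parameter. -/
def LossDominates {Θ 𝒴 : Type*} [MeasurableSpace 𝒴] (P : Θ → Measure 𝒴)
    (L : Θ → Θ → ℝ) (δ : 𝒴 → Θ) (lam₁ lam₂ : 𝒴 → ℝ) : Prop :=
  (∀ θ, lossMSE P L δ lam₁ θ ≤ lossMSE P L δ lam₂ θ) ∧
    ∃ θ, lossMSE P L δ lam₁ θ < lossMSE P L δ lam₂ θ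

/-- A loss estimator is admissible if no (measurable) loss estimator dominates it. -/
def LossAdmissible {Θ 𝒴 : Type*} [MeasurableSpace 𝒴] (P : Θ → Measure 𝒴)
    (L : Θ → Θ → ℝ) (δ : 𝒴 → Θ) (lam : 𝒴 → ℝ) : Prop :=
  ¬ ∃ lam' : 𝒴 → ℝ, Measurable lam' ∧ LossDominates P L δ lam' lam

/-- A loss estimator is inadmissible if it is not admissible. -/
def LossInadmissible {Θ 𝒴 : Type*} [MeasurableSpace 𝒴] (P : Θ → Measure 𝒴)
    (L : Θ → Θ → ℝ) (δ : 𝒴 → Θ) (lam : 𝒴 → ℝ) : Prop :=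
  ¬ LossAdmissible P L δ lam

end General

/-! ### The normal mean matrix -/

section NormalMatrix

/-- Matrices carry the product (equivalently, Borel) σ-algebra of their entries. -/
instance instMeasurableSpaceMatrix {p q : ℕ} : MeasurableSpace (Matrix (Fin p) (Fin q) ℝ) :=
  inferInstanceAs (MeasurableSpace (Fin p → Fin q → ℝ))

/-- The matrix normal distribution `N_{p,q}(M, I_p, I_q)`: the entries `Y i j` are independent and
`Y i j` has law `N(M i j, 1)`. -/
noncomputable def matrixNormal {p q : ℕ} (M : Matrix (Fin p) (Fin q) ℝ) :
    Measure (Matrix (Fin p) (Fin q) ℝ) :=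
  Measure.pi fun i => Measure.pi fun j => gaussianReal (M i j) 1

/-- The Frobenius loss `‖M̂ - M‖_F² = ∑ᵢⱼ (M̂ᵢⱼ - Mᵢⱼ)²`, with the parameter `M` as the first and
the estimate `M̂` as the second argument. -/
def frobeniusLoss {p q : ℕ} (M Mhat : Matrix (Fin p) (Fin q) ℝ) : ℝ :=
  ∑ i, ∑ j, (Mhat i j - M i j) ^ 2

/-- The estimator `M̂(Y) = Y`. -/
def mle {p q : ℕ} (Y : Matrix (Fin p) (Fin q) ℝ) : Matrix (Fin p) (Fin q) ℝ := Y

/-- Stein's unbiased risk estimate of the estimator `δ(Y) = Y + g(Y)` of `M` from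
`Y ∼ N_{p,q}(M, I_p, I_q)` under the Frobenius loss:
`pq + 2 ∑ᵢⱼ ∂gᵢⱼ/∂Yᵢⱼ (Y) + ‖g(Y)‖_F²`. -/
noncomputable def sure {p q : ℕ} (δ : Matrix (Fin p) (Fin q) ℝ → Matrix (Fin p) (Fin q) ℝ)
    (Y : Matrix (Fin p) (Fin q) ℝ) : ℝ :=
  (p : ℝ) * q
    + 2 * ∑ i, ∑ j,
        lineDeriv ℝ (fun Z : Matrix (Fin p) (Fin q) ℝ => δ Z i j - Z i j) Y (Matrix.single i j 1)
    + ∑ i, ∑ j, (δ Y i j - Y i j) ^ 2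

/-- The loss estimator `pq - (2(p - 2q - 2)/q) tr((YᵀY)⁻¹)`. -/
noncomputable def improvedLossEstimator {p q : ℕ} (Y : Matrix (Fin p) (Fin q) ℝ) : ℝ :=
  (p : ℝ) * q - 2 * ((p : ℝ) - 2 * q - 2) / q * ((Yᵀ * Y)⁻¹).trace

end NormalMatrix

end LossEstimation

/-! Write L for the loss, T = tr((YᵀY)⁻¹), κ = (p - 2q - 2)/q and c = 2κ. Expanding the square, E(pq
- cT - L)² = E(pq - L)² + 2c E[(L - pq)T] + c² E T². Gaussian integration by parts, twice in each
entry, turns E[(L - pq)T] into E[ΔT], with Δ the Laplacian in the entries of Y. Matrix calculus and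
(tr R)² ≤ q tr R² give ΔT ≤ -2κT². The two correction terms then sum to at most (c² - 4κc) E T²,
which is minimal at c = 2κ with value -c² E T².

T is singular where YᵀY is, so the argument runs with R = (YᵀY + εI)⁻¹ in place of the inverse. For
fixed ε > 0, tr R and the derivatives used are bounded, so there are no boundary terms, and the
extra ε-terms in the Laplacian have the favourable sign (`sum_ridgeTraceSecondDeriv_le`). The
resulting bound `lintegral_ridge_le` is uniform in ε and retains the gain c² E(tr R)². That gain is
used three times: it forces YᵀY to be almost surely invertible, it passes to ε → 0 by Fatou, and it
makes the inequality strict at every M. -/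

namespace LossEstimation

/-! ### Algebra and Laplacian of the regularized inverse Gram matrix -/

section RidgeAlgebra

variable {m n : Type*} [Fintype m] [Fintype n] [DecidableEq n]

/-- The regularized inverse Gram matrix `(YᵀY + ε I)⁻¹`. -/
noncomputable def ridgeInv (ε : ℝ) (Y : Matrix m n ℝ) : Matrix n n ℝ := (Yᵀ * Y + ε • 1)⁻¹

lemma posDef_gram_add_smul_one {ε : ℝ} (hε : 0 < ε) (Y : Matrix m n ℝ) :
    (Yᵀ * Y + ε • (1 : Matrix n n ℝ)).PosDef := by
  have h1 : (Yᵀ * Y).PosSemidef := by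
    simpa using Matrix.posSemidef_conjTranspose_mul_self Y
  exact Matrix.PosDef.posSemidef_add h1 (Matrix.PosDef.one.smul hε)

lemma isUnit_det_gram_add_smul_one {ε : ℝ} (hε : 0 < ε) (Y : Matrix m n ℝ) :
    IsUnit (Yᵀ * Y + ε • (1 : Matrix n n ℝ)).det :=
  (posDef_gram_add_smul_one hε Y).det_pos.ne'.isUnit

lemma posDef_ridgeInv {ε : ℝ} (hε : 0 < ε) (Y : Matrix m n ℝ) : (ridgeInv ε Y).PosDef :=
  (posDef_gram_add_smul_one hε Y).inv

lemma transpose_ridgeInv {ε : ℝ} (hε : 0 < ε) (Y : Matrix m n ℝ) :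
    (ridgeInv ε Y)ᵀ = ridgeInv ε Y := by
  simpa using (posDef_ridgeInv hε Y).1.eq

lemma ridgeInv_mul_gram {ε : ℝ} (hε : 0 < ε) (Y : Matrix m n ℝ) :
    ridgeInv ε Y * (Yᵀ * Y) = 1 - ε • ridgeInv ε Y := by
  have h := Matrix.nonsing_inv_mul _ (isUnit_det_gram_add_smul_one hε Y)
  rw [Matrix.mul_add, Matrix.mul_smul, Matrix.mul_one] at h
  exact eq_sub_of_add_eq h

lemma transpose_mul_ridgeInv_mul_self {ε : ℝ} (hε : 0 < ε) (Y : Matrix m n ℝ) :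
    (Y * ridgeInv ε Y)ᵀ * (Y * ridgeInv ε Y) =
      ridgeInv ε Y - ε • (ridgeInv ε Y * ridgeInv ε Y) := by
  rw [Matrix.transpose_mul, transpose_ridgeInv hε, Matrix.mul_assoc, ← Matrix.mul_assoc Yᵀ,
    ← Matrix.mul_assoc, ridgeInv_mul_gram hε, Matrix.sub_mul, Matrix.one_mul, Matrix.smul_mul]

/-- Diagonal of R = (YR)ᵀ(YR) + εR². Both summands are sums of squares, so this one identity bounds
the entries of R and YR uniformly in Y. -/
lemma ridgeInv_diag {ε : ℝ} (hε : 0 < ε) (Y : Matrix m n ℝ) (j : n) :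
    ridgeInv ε Y j j = ∑ i, (Y * ridgeInv ε Y) i j ^ 2 + ε * ∑ k, ridgeInv ε Y j k ^ 2 := by
  have h := congrFun (congrFun (transpose_mul_ridgeInv_mul_self hε Y) j) j
  have h2 : (ridgeInv ε Y * ridgeInv ε Y) j j = ∑ k, ridgeInv ε Y j k ^ 2 := by
    nth_rewrite 2 [← transpose_ridgeInv hε]
    simp [Matrix.mul_apply, sq]
  rw [Matrix.mul_apply] at h
  simp only [Matrix.transpose_apply, Matrix.sub_apply, Matrix.smul_apply, smul_eq_mul, h2]
    at h
  simp only [← sq] at h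
  linarith

lemma mul_sum_sq_ridgeInv_le {ε : ℝ} (hε : 0 < ε) (Y : Matrix m n ℝ) (j : n) :
    ε * ∑ k, ridgeInv ε Y j k ^ 2 ≤ ridgeInv ε Y j j := by
  rw [ridgeInv_diag hε Y j]
  linarith [Finset.sum_nonneg fun i (_ : i ∈ Finset.univ) => sq_nonneg ((Y * ridgeInv ε Y) i j)]

lemma ridgeInv_diag_le {ε : ℝ} (hε : 0 < ε) (Y : Matrix m n ℝ) (j : n) :
    ridgeInv ε Y j j ≤ ε⁻¹ := by
  have h := mul_sum_sq_ridgeInv_le hε Y j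
  have h2 : ridgeInv ε Y j j ^ 2 ≤ ∑ k, ridgeInv ε Y j k ^ 2 :=
    Finset.single_le_sum (f := fun k => ridgeInv ε Y j k ^ 2) (fun _ _ => sq_nonneg _)
      (Finset.mem_univ j)
  by_contra! hc
  have hpos : 0 < ridgeInv ε Y j j := (inv_pos.2 hε).trans hc
  have h3 : 1 < ε * ridgeInv ε Y j j := by
    rwa [inv_lt_iff_one_lt_mul₀ hε, mul_comm] at hc
  nlinarith [mul_le_mul_of_nonneg_left h2 hε.le]

lemma abs_ridgeInv_le {ε : ℝ} (hε : 0 < ε) (Y : Matrix m n ℝ) (j k : n) :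
    |ridgeInv ε Y j k| ≤ ε⁻¹ := by
  have h := (mul_sum_sq_ridgeInv_le hε Y j).trans (ridgeInv_diag_le hε Y j)
  have h2 : ridgeInv ε Y j k ^ 2 ≤ ∑ l, ridgeInv ε Y j l ^ 2 :=
    Finset.single_le_sum (f := fun l => ridgeInv ε Y j l ^ 2) (fun _ _ => sq_nonneg _)
      (Finset.mem_univ k)
  refine abs_le_of_sq_le_sq ?_ (inv_pos.2 hε).le
  have h3 : ε⁻¹ ^ 2 = ε⁻¹ * ε⁻¹ := sq _
  rw [h3, ← div_eq_inv_mul, le_div_iff₀ hε]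
  nlinarith

lemma abs_mul_ridgeInv_le {ε : ℝ} (hε : 0 < ε) (Y : Matrix m n ℝ) (i : m) (j : n) :
    |(Y * ridgeInv ε Y) i j| ≤ 1 + ε⁻¹ := by
  have h := ridgeInv_diag hε Y j
  have h1 : (Y * ridgeInv ε Y) i j ^ 2 ≤ ∑ l, (Y * ridgeInv ε Y) l j ^ 2 :=
    Finset.single_le_sum (f := fun l => (Y * ridgeInv ε Y) l j ^ 2) (fun _ _ => sq_nonneg _)
      (Finset.mem_univ i)
  have h2 : 0 ≤ ε * ∑ k, ridgeInv ε Y j k ^ 2 :=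
    mul_nonneg hε.le (Finset.sum_nonneg fun _ _ => sq_nonneg _)
  have h3 := ridgeInv_diag_le hε Y j
  have h4 := inv_pos.2 hε
  refine abs_le_of_sq_le_sq ?_ (by positivity)
  nlinarith

/-- The smoothed projection `Y (YᵀY + ε I)⁻¹ Yᵀ` has diagonal entries in `[-1, 1]`. -/
lemma abs_hat_diag_le {ε : ℝ} (hε : 0 < ε) (Y : Matrix m n ℝ) (i : m) :
    |(Y * ridgeInv ε Y * Yᵀ) i i| ≤ 1 := by
  set R := ridgeInv ε Y with hR
  set Q := Y * R * Yᵀ with hQ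
  have hQt : Qᵀ = Q := by
    rw [hQ, Matrix.transpose_mul, Matrix.transpose_mul, Matrix.transpose_transpose,
      transpose_ridgeInv hε, Matrix.mul_assoc]
  -- Q is a projection up to a negative semidefinite error, whence Q i i ^ 2 ≤ Q i i.
  have hQQ : Q * Qᵀ = Q - ε • ((Y * R) * (Y * R)ᵀ) := by
    have : Q * Qᵀ = Y * (R * (Yᵀ * Y)) * (R * Yᵀ) := by
      rw [hQt, hQ]; simp only [Matrix.mul_assoc]
    rw [this, ridgeInv_mul_gram hε, ← hR, Matrix.transpose_mul, hR, transpose_ridgeInv hε, ← hR]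
    simp only [Matrix.mul_sub, Matrix.sub_mul, Matrix.mul_one, Matrix.mul_smul, Matrix.smul_mul,
      hQ, Matrix.mul_assoc]
  have h := congrFun (congrFun hQQ i) i
  simp only [Matrix.mul_apply, Matrix.transpose_apply, Matrix.sub_apply, Matrix.smul_apply,
    smul_eq_mul, ← sq] at h
  have h1 : Q i i ^ 2 ≤ ∑ l, Q i l ^ 2 :=
    Finset.single_le_sum (f := fun l => Q i l ^ 2) (fun _ _ => sq_nonneg _) (Finset.mem_univ i)
  have h2 : 0 ≤ ε * ∑ k, (∑ l, Y i l * R l k) ^ 2 :=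
    mul_nonneg hε.le (Finset.sum_nonneg fun _ _ => sq_nonneg _)
  have h3 : Q i i ^ 2 ≤ Q i i := by linarith
  rw [abs_le]
  constructor <;> nlinarith

/-- If the Gram matrix is singular, the trace of its regularized inverse is at least `ε⁻¹`. -/
lemma inv_le_trace_ridgeInv {ε : ℝ} (hε : 0 < ε) (Y : Matrix m n ℝ)
    (hY : ¬ IsUnit (Yᵀ * Y)) : ε⁻¹ ≤ (ridgeInv ε Y).trace := by
  have hdet : (Yᵀ * Y).det = 0 := by
    by_contra h
    exact hY ((Matrix.isUnit_iff_isUnit_det _).2 (isUnit_iff_ne_zero.2 h))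
  obtain ⟨v, hv, hv0⟩ := Matrix.exists_mulVec_eq_zero_iff.2 hdet
  -- A kernel vector of the Gram matrix is an eigenvector of R with eigenvalue ε⁻¹.
  have hRv : ∀ j, ε * (ridgeInv ε Y *ᵥ v) j = v j := by
    intro j
    have h := congrArg (fun A => A *ᵥ v) (ridgeInv_mul_gram hε Y)
    simp only [← Matrix.mulVec_mulVec, Matrix.sub_mulVec, Matrix.one_mulVec,
      Matrix.smul_mulVec] at h
    have h0 : Yᵀ *ᵥ (Y *ᵥ v) = 0 := by rw [Matrix.mulVec_mulVec, hv0]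
    rw [h0, Matrix.mulVec_zero] at h
    have := congrFun h j
    simp only [Pi.zero_apply, Pi.sub_apply, Pi.smul_apply, smul_eq_mul] at this
    linarith
  have hvpos : 0 < ∑ j, v j ^ 2 := by
    obtain ⟨j, hj⟩ := Function.ne_iff.1 hv
    exact Finset.sum_pos' (fun _ _ => sq_nonneg _) ⟨j, Finset.mem_univ j, by
      have : v j ≠ 0 := hj
      positivity⟩
  -- Cauchy–Schwarz in row j of εRv = v. One factor ε stays with the row sum so that the product is
  -- at most R j j; summing over j then gives the trace.
  have hrow : ∀ j, v j ^ 2 ≤ ε * (ε * ∑ k, ridgeInv ε Y j k ^ 2) * ∑ k, v k ^ 2 := by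
    intro j
    have hcs := Finset.sum_mul_sq_le_sq_mul_sq Finset.univ (fun k => ridgeInv ε Y j k) v
    have : (ridgeInv ε Y *ᵥ v) j = ∑ k, ridgeInv ε Y j k * v k := rfl
    rw [← hRv j, this, mul_pow]
    nlinarith [mul_le_mul_of_nonneg_left hcs (sq_nonneg ε)]
  have hsum : ∑ j, v j ^ 2 ≤ ε * (ridgeInv ε Y).trace * ∑ k, v k ^ 2 := by
    rw [Matrix.trace, Finset.mul_sum Finset.univ _ ε, Finset.sum_mul Finset.univ]
    refine Finset.sum_le_sum fun j _ => (hrow j).trans ?_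
    gcongr
    exact mul_sum_sq_ridgeInv_le hε Y j
  have h1 : 1 ≤ ε * (ridgeInv ε Y).trace := by
    by_contra! hc
    nlinarith
  rwa [inv_le_iff_one_le_mul₀ hε, mul_comm]

/-- The second derivative of `tr (YᵀY + ε I)⁻¹` along the coordinate `(i, j)`. -/
noncomputable def ridgeTraceSecondDeriv (ε : ℝ) (Y : Matrix m n ℝ) (i : m) (j : n) : ℝ :=
  -2 * ((ridgeInv ε Y * ridgeInv ε Y) j j
    - (2 * ((Y * ridgeInv ε Y) i j * (Y * ridgeInv ε Y * ridgeInv ε Y) i j)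
      + (Y * ridgeInv ε Y * Yᵀ) i i * (ridgeInv ε Y * ridgeInv ε Y) j j
      + (Y * ridgeInv ε Y * (Y * ridgeInv ε Y)ᵀ) i i * ridgeInv ε Y j j))

/-- The Laplacian of tr R. Each sum over entries contracts to a trace containing R(YᵀY) = 1 - εR;
the ε-terms are the resulting corrections. -/
lemma sum_ridgeTraceSecondDeriv {ε : ℝ} (hε : 0 < ε) (Y : Matrix m n ℝ) :
    ∑ i, ∑ j, ridgeTraceSecondDeriv ε Y i j =
      -2 * (((Fintype.card m : ℝ) - Fintype.card n - 2) * (ridgeInv ε Y * ridgeInv ε Y).trace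
        - (ridgeInv ε Y).trace ^ 2
        + 2 * ε * (ridgeInv ε Y * ridgeInv ε Y * ridgeInv ε Y).trace
        + 2 * ε * ((ridgeInv ε Y).trace * (ridgeInv ε Y * ridgeInv ε Y).trace)) := by
  set R := ridgeInv ε Y with hR
  have e1 : ∑ i, ∑ j, (Y * R) i j * (Y * R * R) i j = (R * R).trace - ε * (R * R * R).trace := by
    have : ∑ i, ∑ j, (Y * R) i j * (Y * R * R) i j = ((Y * R)ᵀ * (Y * R * R)).trace := by
      rw [Finset.sum_comm]
      simp only [Matrix.trace, Matrix.diag, Matrix.mul_apply, Matrix.transpose_apply]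
    rw [this, ← Matrix.mul_assoc, transpose_mul_ridgeInv_mul_self hε, Matrix.sub_mul,
      Matrix.smul_mul, Matrix.trace_sub, Matrix.trace_smul, smul_eq_mul]
  have e2 : (Y * R * Yᵀ).trace = Fintype.card n - ε * R.trace := by
    rw [Matrix.mul_assoc, Matrix.trace_mul_comm, Matrix.mul_assoc, ridgeInv_mul_gram hε,
      Matrix.trace_sub, Matrix.trace_one, Matrix.trace_smul, smul_eq_mul]
  have e3 : (Y * R * (Y * R)ᵀ).trace = R.trace - ε * (R * R).trace := by
    rw [Matrix.trace_mul_comm, transpose_mul_ridgeInv_mul_self hε, Matrix.trace_sub,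
      Matrix.trace_smul, smul_eq_mul]
  have e4 : ∑ i, ∑ j, ridgeTraceSecondDeriv ε Y i j =
      -2 * (Fintype.card m * (R * R).trace
        - (2 * ∑ i, ∑ j, (Y * R) i j * (Y * R * R) i j
          + (Y * R * Yᵀ).trace * (R * R).trace + (Y * R * (Y * R)ᵀ).trace * R.trace)) := by
    simp only [ridgeTraceSecondDeriv, ← hR, ← Finset.mul_sum, Finset.sum_add_distrib,
      Finset.sum_sub_distrib, ← Finset.sum_mul, Matrix.trace, Matrix.diag, Finset.sum_const,
      Finset.card_univ, nsmul_eq_mul]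
  rw [e4, e1, e2, e3]
  ring

/-- The ε-terms are dropped by positivity, and tr R² ≥ (tr R)²/q absorbs the adverse (tr R)²,
turning the factor p - q - 2 into (p - 2q - 2)/q. -/
lemma sum_ridgeTraceSecondDeriv_le {ε : ℝ} (hε : 0 < ε) (Y : Matrix m n ℝ)
    (hn : 0 < Fintype.card n) (hmn : Fintype.card n + 2 ≤ Fintype.card m) :
    ∑ i, ∑ j, ridgeTraceSecondDeriv ε Y i j ≤
      -2 * (((Fintype.card m : ℝ) - 2 * Fintype.card n - 2) / Fintype.card n)
        * (ridgeInv ε Y).trace ^ 2 := by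
  rw [sum_ridgeTraceSecondDeriv hε]
  set R := ridgeInv ε Y with hR
  have hRt : Rᵀ = R := transpose_ridgeInv hε Y
  have hpsd := (posDef_ridgeInv hε Y).posSemidef
  have h3 : 0 ≤ (R * R * R).trace := by
    have := (hpsd.conjTranspose_mul_mul_same R).trace_nonneg
    rwa [Matrix.conjTranspose_eq_transpose_of_trivial, hRt] at this
  have h1 : 0 ≤ R.trace := hpsd.trace_nonneg
  have h2' : (R * R).trace = ∑ j, ∑ k, R j k ^ 2 := by
    nth_rewrite 2 [← hRt]
    simp [Matrix.trace, Matrix.mul_apply, sq]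
  have h2 : 0 ≤ (R * R).trace := by
    rw [h2']; positivity
  have hc : (0 : ℝ) < Fintype.card n := by exact_mod_cast hn
  have hmn' : (Fintype.card n : ℝ) + 2 ≤ Fintype.card m := by exact_mod_cast hmn
  have hcs : R.trace ^ 2 ≤ Fintype.card n * (R * R).trace := by
    have h := sq_sum_le_card_mul_sum_sq (s := Finset.univ) (f := fun j => R j j)
    rw [Finset.card_univ] at h
    refine h.trans ?_
    rw [h2']
    gcongr with j
    exact Finset.single_le_sum (f := fun k => R j k ^ 2) (fun _ _ => sq_nonneg _)
      (Finset.mem_univ j)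
  have hdiv : R.trace ^ 2 / Fintype.card n ≤ (R * R).trace := by
    rwa [div_le_iff₀ hc, mul_comm]
  have e : ((Fintype.card m : ℝ) - 2 * Fintype.card n - 2) / Fintype.card n * R.trace ^ 2 =
      (Fintype.card m - Fintype.card n - 2) * (R.trace ^ 2 / Fintype.card n) - R.trace ^ 2 := by
    field_simp
    ring
  have h4 := mul_le_mul_of_nonneg_left hdiv
    (by linarith : (0 : ℝ) ≤ Fintype.card m - Fintype.card n - 2)
  have h5 : 0 ≤ 2 * ε * (R * R * R).trace := by positivity
  have h6 : 0 ≤ 2 * ε * (R.trace * (R * R).trace) := by positivity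
  rw [mul_assoc (-2), e]
  linarith

end RidgeAlgebra

/-! ### Entrywise calculus for matrix-valued curves -/

section EntrywiseDerivative

variable {l m n : Type*}

/-- `A` has derivative `A'` at `x`, entry by entry. -/
def HasEntrywiseDerivAt (A : ℝ → Matrix m n ℝ) (A' : Matrix m n ℝ) (x : ℝ) : Prop :=
  ∀ i j, HasDerivAt (fun t => A t i j) (A' i j) x

lemma HasEntrywiseDerivAt.mul [Fintype n] {A : ℝ → Matrix m n ℝ} {B : ℝ → Matrix n l ℝ}
    {A' : Matrix m n ℝ} {B' : Matrix n l ℝ} {x : ℝ} (hA : HasEntrywiseDerivAt A A' x)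
    (hB : HasEntrywiseDerivAt B B' x) :
    HasEntrywiseDerivAt (fun t => A t * B t) (A' * B x + A x * B') x := by
  intro i j
  simp only [Matrix.mul_apply, Matrix.add_apply, ← Finset.sum_add_distrib]
  exact HasDerivAt.fun_sum fun a _ => (hA i a).mul (hB a j)

lemma HasEntrywiseDerivAt.transpose {A : ℝ → Matrix m n ℝ} {A' : Matrix m n ℝ} {x : ℝ}
    (hA : HasEntrywiseDerivAt A A' x) : HasEntrywiseDerivAt (fun t => (A t)ᵀ) A'ᵀ x :=
  fun i j => hA j i

lemma HasEntrywiseDerivAt.add_const {A : ℝ → Matrix m n ℝ} {A' : Matrix m n ℝ} {x : ℝ}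
    (hA : HasEntrywiseDerivAt A A' x) (B : Matrix m n ℝ) :
    HasEntrywiseDerivAt (fun t => A t + B) A' x :=
  fun i j => (hA i j).add_const (B i j)

-- The norm is auxiliary: it gives access to the derivative of `Ring.inverse`, while the conclusion
-- is norm-free.
attribute [local instance] Matrix.linftyOpNormedRing Matrix.linftyOpNormedAlgebra in
lemma HasEntrywiseDerivAt.inv [Fintype n] [DecidableEq n] {A : ℝ → Matrix n n ℝ}
    {A' : Matrix n n ℝ} {x : ℝ} (hA : HasEntrywiseDerivAt A A' x) (hx : IsUnit (A x)) :
    HasEntrywiseDerivAt (fun t => (A t)⁻¹) (-((A x)⁻¹ * A' * (A x)⁻¹)) x := by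
  have hA1 : HasDerivAt A A' x := by
    exact hasDerivAt_pi.2 fun i => hasDerivAt_pi.2 fun j => hA i j
  obtain ⟨u, hu⟩ := hx
  have h := (hu ▸ hasFDerivAt_ringInverse (𝕜 := ℝ) u : HasFDerivAt Ring.inverse _ (A x))
  have h2 := h.comp_hasDerivAt x hA1
  have hinv : (↑u⁻¹ : Matrix n n ℝ) = (A x)⁻¹ := by
    rw [← hu, Matrix.coe_units_inv]
  intro i j
  have h3 := hasDerivAt_pi.1 (hasDerivAt_pi.1 h2 i) j
  simp only [hinv] at h3
  simpa [Matrix.nonsing_inv_eq_ringInverse, Function.comp_def, mul_assoc] using h3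

lemma HasEntrywiseDerivAt.trace [Fintype n] {A : ℝ → Matrix n n ℝ} {A' : Matrix n n ℝ} {x : ℝ}
    (hA : HasEntrywiseDerivAt A A' x) : HasDerivAt (fun t => (A t).trace) A'.trace x := by
  simp only [Matrix.trace, Matrix.diag]
  exact HasDerivAt.fun_sum fun a _ => hA a a

end EntrywiseDerivative

/-! ### First and second derivatives of tr R along one entry -/

section RidgeDerivative

variable {m n : Type*} [Fintype m] [Fintype n] [DecidableEq n]

lemma mul_single_mul_apply [DecidableEq m] {k l : Type*} (A : Matrix k m ℝ) (B : Matrix n l ℝ) (a : m) (b : n)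
    (i : k) (j : l) : (A * Matrix.single a b (1 : ℝ) * B) i j = A i a * B b j := by
  rw [Matrix.mul_apply, Finset.sum_eq_single b]
  · simp
  · intro c _ hc
    rw [Matrix.mul_single_apply_of_ne _ _ _ _ _ hc, zero_mul]
  · simp

lemma hasEntrywiseDerivAt_ridgeInv {ε : ℝ} (hε : 0 < ε) {Y : ℝ → Matrix m n ℝ}
    {E : Matrix m n ℝ} {x : ℝ} (hY : HasEntrywiseDerivAt Y E x) :
    HasEntrywiseDerivAt (fun t => ridgeInv ε (Y t))
      (-(ridgeInv ε (Y x) * (Eᵀ * Y x + (Y x)ᵀ * E) * ridgeInv ε (Y x))) x :=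
  ((hY.transpose.mul hY).add_const _).inv (posDef_gram_add_smul_one hε _).isUnit

lemma hasDerivAt_trace_ridgeInv [DecidableEq m] {ε : ℝ} (hε : 0 < ε) {Y : ℝ → Matrix m n ℝ} {i : m} {j : n}
    {x : ℝ} (hY : HasEntrywiseDerivAt Y (Matrix.single i j 1) x) :
    HasDerivAt (fun t => (ridgeInv ε (Y t)).trace)
      (-2 * (Y x * ridgeInv ε (Y x) * ridgeInv ε (Y x)) i j) x := by
  refine (hasEntrywiseDerivAt_ridgeInv hε hY).trace.congr_deriv ?_
  set R := ridgeInv ε (Y x) with hR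
  have hRt : Rᵀ = R := transpose_ridgeInv hε _
  have e1 : (R * ((Y x)ᵀ * Matrix.single i j (1 : ℝ)) * R).trace = (Y x * R * R) i j := by
    rw [Matrix.trace_mul_comm, ← Matrix.mul_assoc, ← Matrix.mul_assoc, Matrix.trace_mul_single]
    have : R * R * (Y x)ᵀ = (Y x * R * R)ᵀ := by
      simp [Matrix.transpose_mul, hRt, Matrix.mul_assoc]
    rw [this]
    simp
  -- The two halves of the derivative of YᵀY are transposes of each other, which produces the factor
  -- 2.
  have e2 : (R * ((Matrix.single i j (1 : ℝ))ᵀ * Y x) * R).trace = (Y x * R * R) i j := by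
    rw [← Matrix.trace_transpose]
    have : (R * ((Matrix.single i j (1 : ℝ))ᵀ * Y x) * R)ᵀ =
        R * ((Y x)ᵀ * Matrix.single i j (1 : ℝ)) * R := by
      simp only [Matrix.transpose_mul, hRt, Matrix.transpose_transpose, Matrix.mul_assoc]
    rw [this, e1]
  rw [Matrix.trace_neg, Matrix.mul_add, Matrix.add_mul, Matrix.trace_add, e1, e2]
  ring

lemma hasDerivAt_mul_ridgeInv_mul_ridgeInv [DecidableEq m] {ε : ℝ} (hε : 0 < ε) {Y : ℝ → Matrix m n ℝ} {i : m}
    {j : n} {x : ℝ} (hY : HasEntrywiseDerivAt Y (Matrix.single i j 1) x) :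
    HasDerivAt (fun t => -2 * (Y t * ridgeInv ε (Y t) * ridgeInv ε (Y t)) i j)
      (ridgeTraceSecondDeriv ε (Y x) i j) x := by
  have hR' := hasEntrywiseDerivAt_ridgeInv hε hY
  refine (((hY.mul hR').mul hR') i j).const_mul (-2) |>.congr_deriv ?_
  rw [ridgeTraceSecondDeriv]
  set R := ridgeInv ε (Y x) with hR
  have hRt : Rᵀ = R := transpose_ridgeInv hε _
  set Z := Y x
  -- Every term is brought to the form A * E * B with E a matrix unit, so that its (i, j) entry
  -- factors into an entry of A times an entry of B.
  have key : ((Matrix.single i j (1 : ℝ) * R + Z * -(R * ((Matrix.single i j (1 : ℝ))ᵀ * Z +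
      Zᵀ * Matrix.single i j (1 : ℝ)) * R)) * R + Z * R * -(R * ((Matrix.single i j (1 : ℝ))ᵀ * Z +
      Zᵀ * Matrix.single i j (1 : ℝ)) * R)) =
      (1 : Matrix m m ℝ) * Matrix.single i j (1 : ℝ) * (R * R) - ((Z * R) * Matrix.single j i (1 : ℝ) * (Z * R * R)
        + (Z * R * Zᵀ) * Matrix.single i j (1 : ℝ) * (R * R)
        + (Z * R * R) * Matrix.single j i (1 : ℝ) * (Z * R)
        + (Z * R * (Z * R)ᵀ) * Matrix.single i j (1 : ℝ) * R) := by
    rw [Matrix.transpose_single, Matrix.transpose_mul, hRt]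
    simp only [Matrix.mul_add, Matrix.add_mul, Matrix.mul_neg, Matrix.neg_mul, Matrix.mul_assoc,
      Matrix.one_mul]
    abel
  rw [key]
  simp only [Matrix.add_apply, Matrix.sub_apply, mul_single_mul_apply, Matrix.one_apply_eq]
  ring

end RidgeDerivative

/-! ### Integrating out one coordinate of a product measure -/

section ProductMeasure

variable {ι : Type*} [Fintype ι] [DecidableEq ι] {α : ι → Type*} [∀ i, MeasurableSpace (α i)]

/-- Resampling one coordinate independently leaves a product probability measure unchanged. -/
lemma measurePreserving_update (μ : ∀ i, Measure (α i)) [∀ i, IsProbabilityMeasure (μ i)] (i : ι) :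
    MeasurePreserving (fun z : (∀ j, α j) × α i => Function.update z.1 i z.2)
      ((Measure.pi μ).prod (μ i)) (Measure.pi μ) := by
  have hmeas : Measurable fun z : (∀ j, α j) × α i => Function.update z.1 i z.2 :=
    measurable_update'
  refine ⟨hmeas, (Measure.pi_eq fun s hs => ?_).symm⟩
  rw [Measure.map_apply hmeas (MeasurableSet.univ_pi hs)]
  have : (fun z : (∀ j, α j) × α i => Function.update z.1 i z.2) ⁻¹' Set.univ.pi s =
      (Set.univ.pi (Function.update s i Set.univ)) ×ˢ s i := by
    ext z
    simp only [Set.mem_preimage, Set.mem_univ_pi, Set.mem_prod]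
    constructor
    · intro h
      refine ⟨fun j => ?_, by simpa using h i⟩
      by_cases hj : j = i
      · subst hj; simp
      · simpa [hj] using h j
    · rintro ⟨h, hi⟩ j
      by_cases hj : j = i
      · subst hj; simpa using hi
      · simpa [hj] using h j
  rw [this, Measure.prod_prod, Measure.pi_pi, ← Finset.prod_erase_mul _ _ (Finset.mem_univ i),
    ← Finset.prod_erase_mul Finset.univ (fun j => μ j (s j)) (Finset.mem_univ i)]
  simp only [Function.update_self, measure_univ, mul_one]
  congr 1
  refine Finset.prod_congr rfl fun j hj => ?_
  rw [Function.update_of_ne (Finset.ne_of_mem_erase hj)]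

lemma integral_pi_eq_zero_of_update (μ : ∀ i, Measure (α i)) [∀ i, IsProbabilityMeasure (μ i)]
    (i : ι) (f : (∀ j, α j) → ℝ) (h : ∀ y, ∫ t, f (Function.update y i t) ∂(μ i) = 0) :
    ∫ y, f y ∂(Measure.pi μ) = 0 := by
  by_cases hf : Integrable f (Measure.pi μ)
  · have hmp := measurePreserving_update μ i
    have hf' : AEStronglyMeasurable f
        (((Measure.pi μ).prod (μ i)).map fun z => Function.update z.1 i z.2) := by
      rw [hmp.map_eq]; exact hf.1
    rw [← hmp.map_eq, integral_map hmp.measurable.aemeasurable hf',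
      integral_prod (fun z : (∀ j, α j) × α i => f (Function.update z.1 i z.2))
        ((hmp.integrable_comp hf.1).2 hf)]
    simp [h]
  -- The Bochner integral of a non-integrable function is 0 by convention, so no integrability
  -- hypothesis is needed.
  · exact integral_undef hf

end ProductMeasure

/-! ### One-dimensional Stein identity -/

section Gaussian

/-- Second order Gaussian integration by parts for bounded functions. -/
lemma integral_gaussianReal_sq_sub_one_mul (μ : ℝ) {φ φ' φ'' : ℝ → ℝ}
    (h1 : ∀ x, HasDerivAt φ (φ' x) x) (h2 : ∀ x, HasDerivAt φ' (φ'' x) x)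
    {C : ℝ} (hb0 : ∀ x, |φ x| ≤ C) (hb1 : ∀ x, |φ' x| ≤ C)
    (hb2 : ∀ x, |φ'' x| ≤ C) :
    ∫ x, (((x - μ) ^ 2 - 1) * φ x - φ'' x) ∂(gaussianReal μ 1) = 0 := by
  have hv : (1 : NNReal) ≠ 0 := one_ne_zero
  have hφ : Continuous φ := continuous_iff_continuousAt.2 fun x => (h1 x).continuousAt
  have hφ' : Continuous φ' := continuous_iff_continuousAt.2 fun x => (h2 x).continuousAt
  have hm : Measurable φ'' := (funext fun x => (h2 x).deriv : deriv φ' = φ'') ▸ measurable_deriv φ'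
  have hint : ∀ g : ℝ → ℝ, Integrable g (gaussianReal μ 1) →
      Integrable fun x => gaussianPDFReal μ 1 x * g x := by
    intro g hg
    rw [gaussianReal_of_var_ne_zero _ hv,
      integrable_withDensity_iff_integrable_smul' (by fun_prop) (by
        exact .of_forall fun _ => gaussianPDF_lt_top)] at hg
    simpa [toReal_gaussianPDF] using hg
  have hx1 : Integrable (fun x => x - μ) (gaussianReal μ 1) :=
    (memLp_one_iff_integrable.1 (memLp_id_gaussianReal 1)).sub (integrable_const _)
  have hx2 : Integrable (fun x => (x - μ) ^ 2) (gaussianReal μ 1) :=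
    ((memLp_id_gaussianReal 2).sub (memLp_const μ)).integrable_sq
  have hi0 : Integrable φ (gaussianReal μ 1) :=
    .of_bound hφ.aestronglyMeasurable C (.of_forall hb0)
  have hi1 : Integrable φ' (gaussianReal μ 1) :=
    .of_bound hφ'.aestronglyMeasurable C (.of_forall hb1)
  have hi2 : Integrable φ'' (gaussianReal μ 1) :=
    .of_bound hm.aestronglyMeasurable C (.of_forall hb2)
  have hA : Integrable (fun x => ((x - μ) ^ 2 - 1) * φ x - φ'' x) (gaussianReal μ 1) :=
    ((hx2.sub (integrable_const 1)).mul_bdd (c := C) hφ.aestronglyMeasurable (.of_forall hb0)).sub hi2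
  have hB : Integrable (fun x => -((x - μ) * φ x) - φ' x) (gaussianReal μ 1) :=
    (hx1.mul_bdd (c := C) hφ.aestronglyMeasurable (.of_forall hb0)).neg.sub hi1
  have hpdf : ∀ x, HasDerivAt (gaussianPDFReal μ 1) (-(x - μ) * gaussianPDFReal μ 1 x) x := by
    intro x
    have h0 : HasDerivAt (fun x : ℝ => -(x - μ) ^ 2 / (2 * (1 : NNReal))) (-(x - μ)) x := by
      have := ((((hasDerivAt_id x).sub_const μ).pow 2).neg).div_const (2 * ((1 : NNReal) : ℝ))
      refine HasDerivAt.congr_deriv this ?_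
      simp
      ring
    have := (h0.exp).const_mul ((√(2 * Real.pi * (1 : NNReal)))⁻¹)
    rw [gaussianPDFReal_def]
    refine HasDerivAt.congr_deriv this ?_
    ring
  rw [integral_gaussianReal_eq_integral_smul hv]
  simp only [smul_eq_mul]
  -- The density times the integrand is an exact derivative: differentiating the density in this
  -- primitive yields (x - μ)²φ, and the two (x - μ)φ' terms cancel.
  refine integral_eq_zero_of_hasDerivAt_of_integrable (f := fun x => gaussianPDFReal μ 1 x *
    (-((x - μ) * φ x) - φ' x)) (fun x => ?_) (hint _ hA) (hint _ hB)
  have := (hpdf x).mul (((((hasDerivAt_id x).sub_const μ).mul (h1 x)).neg).sub (h2 x))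
  refine HasDerivAt.congr_deriv this ?_
  simp
  ring

end Gaussian

/-! ### Bounds uniform in Y for fixed ε -/

section RidgeBounds

variable {k l m n : Type*} [Fintype m] [Fintype n]

lemma abs_matrix_mul_apply_le {A : Matrix k n ℝ} {B : Matrix n l ℝ} {a b : ℝ} (ha : 0 ≤ a)
    (hA : ∀ i j, |A i j| ≤ a) (hB : ∀ i j, |B i j| ≤ b) (i : k) (j : l) :
    |(A * B) i j| ≤ Fintype.card n * (a * b) := by
  rw [Matrix.mul_apply]
  refine (Finset.abs_sum_le_sum_abs _ _).trans ?_
  rw [← nsmul_eq_mul]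
  refine Finset.sum_le_card_nsmul _ _ _ fun c _ => ?_
  rw [abs_mul]
  exact mul_le_mul (hA i c) (hB c j) (abs_nonneg _) ha

lemma abs_trace_ridgeInv_le [DecidableEq n] {ε : ℝ} (hε : 0 < ε) (Y : Matrix m n ℝ) :
    |(ridgeInv ε Y).trace| ≤ Fintype.card n * ε⁻¹ := by
  refine (Finset.abs_sum_le_sum_abs _ _).trans ?_
  rw [← nsmul_eq_mul]
  exact Finset.sum_le_card_nsmul _ _ _ fun c _ => abs_ridgeInv_le hε Y c c

lemma abs_mul_ridgeInv_mul_ridgeInv_le [DecidableEq n] {ε : ℝ} (hε : 0 < ε) (Y : Matrix m n ℝ)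
    (i : m) (j : n) :
    |(Y * ridgeInv ε Y * ridgeInv ε Y) i j| ≤ Fintype.card n * ((1 + ε⁻¹) * ε⁻¹) :=
  have := inv_pos.2 hε
  abs_matrix_mul_apply_le (by positivity) (abs_mul_ridgeInv_le hε Y) (abs_ridgeInv_le hε Y) i j

/-- Y is unbounded, but it occurs only inside YR and YRYᵀ, whose relevant entries are bounded. -/
lemma exists_abs_ridgeTraceSecondDeriv_le [DecidableEq n] {ε : ℝ} (hε : 0 < ε) :
    ∃ C, ∀ (Y : Matrix m n ℝ) (i : m) (j : n), |ridgeTraceSecondDeriv ε Y i j| ≤ C := by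
  have h0 := inv_pos.2 hε
  refine ⟨2 * (Fintype.card n * (ε⁻¹ * ε⁻¹) + (2 * ((1 + ε⁻¹) *
    (Fintype.card n * ((1 + ε⁻¹) * ε⁻¹))) + 1 * (Fintype.card n * (ε⁻¹ * ε⁻¹)) +
    Fintype.card n * ((1 + ε⁻¹) * (1 + ε⁻¹)) * ε⁻¹)), fun Y i j => ?_⟩
  have hRR := abs_matrix_mul_apply_le h0.le (abs_ridgeInv_le hε Y) (abs_ridgeInv_le hε Y) j j
  have hP := abs_matrix_mul_apply_le (by positivity) (abs_mul_ridgeInv_le hε Y)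
    (B := (Y * ridgeInv ε Y)ᵀ) (fun a b => abs_mul_ridgeInv_le hε Y b a) i i
  rw [ridgeTraceSecondDeriv, abs_mul, abs_neg, abs_two]
  refine mul_le_mul_of_nonneg_left ((abs_sub _ _).trans (add_le_add hRR
    ((abs_add_le _ _).trans (add_le_add ((abs_add_le _ _).trans (add_le_add ?_ ?_)) ?_)))) zero_le_two
  · rw [abs_mul, abs_two, abs_mul]
    gcongr
    · exact abs_mul_ridgeInv_le hε Y i j
    · exact abs_mul_ridgeInv_mul_ridgeInv_le hε Y i j
  · rw [abs_mul]
    gcongr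
    exact abs_hat_diag_le hε Y i
  · rw [abs_mul]
    gcongr
    exact abs_ridgeInv_le hε Y j j

end RidgeBounds

/-! ### Measurability of matrix operations -/

section Measurability

variable {k l m n α : Type*} [Fintype m] [Fintype n] [MeasurableSpace α]

lemma measurable_matrix_mul_apply {A : α → Matrix k n ℝ} {B : α → Matrix n l ℝ}
    (hA : ∀ i j, Measurable fun a => A a i j) (hB : ∀ i j, Measurable fun a => B a i j)
    (i : k) (j : l) : Measurable fun a => (A a * B a) i j := by
  simp only [Matrix.mul_apply]
  exact Finset.measurable_fun_sum _ fun c _ => (hA i c).mul (hB c j)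

lemma measurable_matrix_det [DecidableEq n] {A : α → Matrix n n ℝ}
    (hA : ∀ i j, Measurable fun a => A a i j) :
    Measurable fun a => (A a).det := by
  simp only [Matrix.det_apply]
  exact Finset.measurable_fun_sum _ fun σ _ =>
    (Finset.measurable_fun_prod _ fun c _ => hA (σ c) c).const_smul _

/-- Adjugate over determinant holds everywhere, singular matrices included, since both conventions
give 0 there. -/
lemma measurable_matrix_inv_apply [DecidableEq n] {A : α → Matrix n n ℝ}
    (hA : ∀ i j, Measurable fun a => A a i j) (i j : n) :
    Measurable fun a => (A a)⁻¹ i j := by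
  simp only [Matrix.inv_def, Ring.inverse_eq_inv', Matrix.smul_apply, smul_eq_mul,
    Matrix.adjugate_apply]
  refine (measurable_matrix_det hA).inv.mul (measurable_matrix_det fun a b => ?_)
  by_cases h : a = j
  · subst h; simp
  · simpa [Matrix.updateRow_ne h] using hA a b

lemma measurable_matrix_trace {A : α → Matrix n n ℝ} (hA : ∀ i j, Measurable fun a => A a i j) :
    Measurable fun a => (A a).trace :=
  Finset.measurable_fun_sum _ fun c _ => hA c c

lemma measurable_gram_apply {A : α → Matrix m l ℝ} (hA : ∀ i j, Measurable fun a => A a i j)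
    (i j : l) : Measurable fun a => ((A a)ᵀ * A a) i j :=
  measurable_matrix_mul_apply (fun a b => hA b a) hA i j

lemma measurable_ridgeInv_apply [DecidableEq n] (ε : ℝ) {A : α → Matrix m n ℝ}
    (hA : ∀ i j, Measurable fun a => A a i j) (i j : n) :
    Measurable fun a => ridgeInv ε (A a) i j :=
  measurable_matrix_inv_apply (fun b c => (measurable_gram_apply hA b c).add_const _) i j

lemma measurable_ridgeTraceSecondDeriv [DecidableEq n] (ε : ℝ) {A : α → Matrix m n ℝ}
    (hA : ∀ i j, Measurable fun a => A a i j) (i : m) (j : n) :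
    Measurable fun a => ridgeTraceSecondDeriv ε (A a) i j := by
  have hR := measurable_ridgeInv_apply ε hA
  have hYR := measurable_matrix_mul_apply hA hR
  have hRR := measurable_matrix_mul_apply hR hR
  have hYRR := measurable_matrix_mul_apply hYR hR
  have hQ := measurable_matrix_mul_apply (l := m) hYR (B := fun a => (A a)ᵀ) fun b c => hA c b
  have hP := measurable_matrix_mul_apply (l := m) hYR (B := fun a => (A a * ridgeInv ε (A a))ᵀ)
    fun b c => hYR c b
  exact ((hRR j j).sub (((((hYR i j).mul (hYRR i j)).const_mul 2).add
    ((hQ i i).mul (hRR j j))).add ((hP i i).mul (hR j j)))).const_mul (-2)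

end Measurability

/-! ### The limit ε → 0 -/

section RidgeLimit

variable {m n : Type*} [Fintype m] [Fintype n] [DecidableEq n]

lemma tendsto_trace_ridgeInv {Y : Matrix m n ℝ} (hY : IsUnit (Yᵀ * Y)) :
    Filter.Tendsto (fun ε => (ridgeInv ε Y).trace) (nhds 0) (nhds ((Yᵀ * Y)⁻¹).trace) := by
  have hc : Continuous fun ε : ℝ => Yᵀ * Y + ε • (1 : Matrix n n ℝ) := by fun_prop
  have hdet : (Yᵀ * Y + (0 : ℝ) • (1 : Matrix n n ℝ)).det ≠ 0 := by
    rw [zero_smul, add_zero]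
    exact ((Matrix.isUnit_iff_isUnit_det _).1 hY).ne_zero
  have h : ContinuousAt (fun ε : ℝ => (ridgeInv ε Y).trace) 0 := by
    simp only [ridgeInv, Matrix.inv_def, Ring.inverse_eq_inv', Matrix.trace_smul, smul_eq_mul]
    exact (hc.matrix_det.continuousAt.inv₀ hdet).mul hc.matrix_adjugate.matrix_trace.continuousAt
  simpa [ContinuousAt, ridgeInv] using h

lemma trace_inv_gram_pos [Nonempty n] {Y : Matrix m n ℝ} (hY : IsUnit (Yᵀ * Y)) :
    0 < ((Yᵀ * Y)⁻¹).trace := by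
  have h1 : (Yᵀ * Y).PosSemidef := by
    simpa using Matrix.posSemidef_conjTranspose_mul_self Y
  exact (h1.posDef_iff_isUnit.2 hY).inv.trace_pos

end RidgeLimit

/-! ### Risk comparison under the matrix normal law -/

section MatrixNormal

variable {p q : ℕ} (M : Matrix (Fin p) (Fin q) ℝ)

instance isProbabilityMeasure_pi_gaussianReal (i : Fin p) :
    IsProbabilityMeasure (Measure.pi fun j => gaussianReal (M i j) 1) :=
  inferInstance

instance isProbabilityMeasure_matrixNormal : IsProbabilityMeasure (matrixNormal M) :=
  inferInstanceAs (IsProbabilityMeasure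
    (Measure.pi fun i => Measure.pi fun j => gaussianReal (M i j) 1))

lemma measurable_matrix_entry (i : Fin p) (j : Fin q) :
    Measurable fun Y : Matrix (Fin p) (Fin q) ℝ => Y i j :=
  (measurable_pi_apply j).comp (measurable_pi_apply (X := fun _ : Fin p => Fin q → ℝ) i)

lemma measurePreserving_matrix_entry (i : Fin p) (j : Fin q) :
    MeasurePreserving (fun Y : Matrix (Fin p) (Fin q) ℝ => Y i j) (matrixNormal M)
      (gaussianReal (M i j) 1) :=
  (measurePreserving_eval (fun j => gaussianReal (M i j) 1) j).comp
    (measurePreserving_eval (fun i => Measure.pi fun j => gaussianReal (M i j) 1) i)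

lemma memLp_matrix_entry_sub_sq (i : Fin p) (j : Fin q) :
    MemLp (fun Y : Matrix (Fin p) (Fin q) ℝ => (Y i j - M i j) ^ 2) 2 (matrixNormal M) := by
  have h : MemLp (fun x : ℝ => x - M i j) 4 (gaussianReal (M i j) 1) :=
    (memLp_id_gaussianReal 4).sub (memLp_const _)
  have h2 : MemLp (fun x : ℝ => (x - M i j) ^ 2) 2 (gaussianReal (M i j) 1) := by
    rw [memLp_two_iff_integrable_sq (by fun_prop)]
    simpa [← pow_mul, Even.pow_abs (show Even 4 by decide)] using
      h.integrable_norm_pow (p := 4) (by norm_num)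
  exact h2.comp_measurePreserving (measurePreserving_matrix_entry M i j)

lemma measurable_frobeniusLoss : Measurable fun Y => frobeniusLoss M Y :=
  Finset.measurable_fun_sum _ fun i _ => Finset.measurable_fun_sum _ fun j _ =>
    ((measurable_matrix_entry i j).sub_const _).pow_const 2

lemma memLp_frobeniusLoss : MemLp (fun Y => frobeniusLoss M Y) 2 (matrixNormal M) :=
  memLp_finsetSum _ fun i _ => memLp_finsetSum _ fun j _ => memLp_matrix_entry_sub_sq M i j

/-- The Stein identity in one entry with all others frozen. The law is a product of products, so a
row and then an entry in it are resampled. -/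
lemma integral_entry_ridge {ε : ℝ} (hε : 0 < ε) (i : Fin p) (j : Fin q) :
    ∫ Y, (((Y i j - M i j) ^ 2 - 1) * (ridgeInv ε Y).trace - ridgeTraceSecondDeriv ε Y i j)
      ∂(matrixNormal M) = 0 := by
  refine integral_pi_eq_zero_of_update (fun i => Measure.pi fun j => gaussianReal (M i j) 1) i _
    fun Y => ?_
  refine integral_pi_eq_zero_of_update (fun j => gaussianReal (M i j) 1) j _ fun r => ?_
  let Z : ℝ → Matrix (Fin p) (Fin q) ℝ := fun t => Function.update Y i (Function.update r j t)
  have hZ : ∀ x, HasEntrywiseDerivAt Z (Matrix.single i j 1) x := by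
    intro x a b
    by_cases ha : a = i
    · subst ha
      by_cases hb : b = j
      · subst hb
        simpa [Z] using hasDerivAt_id' x
      · simpa [Z, hb, Ne.symm hb] using hasDerivAt_const x (r b)
    · simpa [Z, ha, Ne.symm ha] using hasDerivAt_const x (Y a b)
  have hZij : ∀ t, Z t i j = t := by simp [Z]
  obtain ⟨C, hC⟩ := exists_abs_ridgeTraceSecondDeriv_le (m := Fin p) (n := Fin q) hε
  obtain ⟨B, hB0, hB1, hB2⟩ : ∃ B : ℝ, Fintype.card (Fin q) * ε⁻¹ ≤ B ∧
      2 * (Fintype.card (Fin q) * ((1 + ε⁻¹) * ε⁻¹)) ≤ B ∧ C ≤ B :=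
    ⟨max (Fintype.card (Fin q) * ε⁻¹)
      (max (2 * (Fintype.card (Fin q) * ((1 + ε⁻¹) * ε⁻¹))) C), by simp, by simp, by simp⟩
  have key := integral_gaussianReal_sq_sub_one_mul (M i j)
    (fun x => hasDerivAt_trace_ridgeInv hε (hZ x))
    (fun x => hasDerivAt_mul_ridgeInv_mul_ridgeInv hε (hZ x)) (C := B)
    (fun x => (abs_trace_ridgeInv_le hε _).trans hB0)
    (fun x => by
      rw [abs_mul, abs_neg, abs_two]
      exact (mul_le_mul_of_nonneg_left (abs_mul_ridgeInv_mul_ridgeInv_le hε _ i j)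
        zero_le_two).trans hB1)
    (fun x => (hC _ i j).trans hB2)
  rw [← key]
  refine integral_congr_ae (.of_forall fun t => ?_)
  change ((Z t i j - M i j) ^ 2 - 1) * _ - _ = _
  rw [hZij]

lemma measurable_trace_ridgeInv (ε : ℝ) :
    Measurable fun Y : Matrix (Fin p) (Fin q) ℝ => (ridgeInv ε Y).trace :=
  measurable_matrix_trace (measurable_ridgeInv_apply ε measurable_matrix_entry)

lemma memLp_trace_ridgeInv {ε : ℝ} (hε : 0 < ε) (r : ℝ≥0∞) :
    MemLp (fun Y => (ridgeInv ε Y).trace) r (matrixNormal M) :=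
  MemLp.of_bound (measurable_trace_ridgeInv ε).aestronglyMeasurable _
    (.of_forall fun Y => abs_trace_ridgeInv_le hε Y)

lemma integrable_ridgeTraceSecondDeriv {ε : ℝ} (hε : 0 < ε) (i : Fin p) (j : Fin q) :
    Integrable (fun Y => ridgeTraceSecondDeriv ε Y i j) (matrixNormal M) := by
  obtain ⟨C, hC⟩ := exists_abs_ridgeTraceSecondDeriv_le (m := Fin p) (n := Fin q) hε
  exact .of_bound (measurable_ridgeTraceSecondDeriv ε measurable_matrix_entry i j
    ).aestronglyMeasurable C (.of_forall fun Y => hC Y i j)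

lemma integrable_frobeniusLoss_sub_mul {ε : ℝ} (hε : 0 < ε) :
    Integrable (fun Y => (frobeniusLoss M Y - p * q) * (ridgeInv ε Y).trace -
      ∑ i, ∑ j, ridgeTraceSecondDeriv ε Y i j) (matrixNormal M) :=
  (((memLp_frobeniusLoss M).sub (memLp_const _)).integrable_mul
    (memLp_trace_ridgeInv M hε 2)).sub
    (integrable_finsetSum _ fun i _ => integrable_finsetSum _ fun j _ =>
      integrable_ridgeTraceSecondDeriv M hε i j)

lemma integral_frobeniusLoss_sub_mul {ε : ℝ} (hε : 0 < ε) :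
    ∫ Y, ((frobeniusLoss M Y - p * q) * (ridgeInv ε Y).trace -
      ∑ i, ∑ j, ridgeTraceSecondDeriv ε Y i j) ∂(matrixNormal M) = 0 := by
  have hint : ∀ i j, Integrable (fun Y : Matrix (Fin p) (Fin q) ℝ =>
      ((Y i j - M i j) ^ 2 - 1) * (ridgeInv ε Y).trace - ridgeTraceSecondDeriv ε Y i j)
      (matrixNormal M) := fun i j =>
    (((memLp_matrix_entry_sub_sq M i j).sub (memLp_const 1)).integrable_mul
      (memLp_trace_ridgeInv M hε 2)).sub (integrable_ridgeTraceSecondDeriv M hε i j)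
  have e : ∀ Y : Matrix (Fin p) (Fin q) ℝ, (frobeniusLoss M Y - p * q) * (ridgeInv ε Y).trace -
      ∑ i, ∑ j, ridgeTraceSecondDeriv ε Y i j = ∑ i, ∑ j,
        (((Y i j - M i j) ^ 2 - 1) * (ridgeInv ε Y).trace - ridgeTraceSecondDeriv ε Y i j) := by
    intro Y
    simp [frobeniusLoss, Finset.sum_sub_distrib, ← Finset.sum_mul]
  simp_rw [e]
  rw [integral_finsetSum _ fun i _ => integrable_finsetSum _ fun j _ => hint i j]
  refine Finset.sum_eq_zero fun i _ => ?_
  rw [integral_finsetSum _ fun j _ => hint i j]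
  exact Finset.sum_eq_zero fun j _ => integral_entry_ridge M hε i j

/-- Mean squared error bound for the regularized loss estimator
`pq - (2(p - 2q - 2)/q) tr((YᵀY + ε I)⁻¹)`. -/
lemma lintegral_ridge_le (hq : 1 ≤ q) (hpq : 2 * q + 3 ≤ p) {ε : ℝ} (hε : 0 < ε) :
    ∫⁻ Y, (ENNReal.ofReal (((p : ℝ) * q - 2 * ((p : ℝ) - 2 * q - 2) / q * (ridgeInv ε Y).trace -
        frobeniusLoss M Y) ^ 2) +
      ENNReal.ofReal ((2 * ((p : ℝ) - 2 * q - 2) / q * (ridgeInv ε Y).trace) ^ 2))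
      ∂(matrixNormal M) ≤
    ∫⁻ Y, ENNReal.ofReal (((p : ℝ) * q - frobeniusLoss M Y) ^ 2) ∂(matrixNormal M) := by
  set κ : ℝ := ((p : ℝ) - 2 * q - 2) / q with hκ
  have hκ2 : 2 * ((p : ℝ) - 2 * q - 2) / q = 2 * κ := by rw [hκ]; ring
  have hκ0 : 0 ≤ κ := by
    have : (2 : ℝ) * q + 3 ≤ p := by exact_mod_cast hpq
    exact div_nonneg (by linarith) (Nat.cast_nonneg q)
  simp_rw [hκ2, ← ENNReal.ofReal_add (sq_nonneg _) (sq_nonneg _)]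
  have hL := memLp_frobeniusLoss M
  have hT := (memLp_trace_ridgeInv M hε 2).const_mul (2 * κ)
  have hX : MemLp (fun Y => (p : ℝ) * q - frobeniusLoss M Y) 2 (matrixNormal M) :=
    (memLp_const _).sub hL
  have hXT : MemLp (fun Y => (p : ℝ) * q - 2 * κ * (ridgeInv ε Y).trace - frobeniusLoss M Y) 2
      (matrixNormal M) := ((memLp_const _).sub hT).sub hL
  have hi1 : Integrable (fun Y => ((p : ℝ) * q - 2 * κ * (ridgeInv ε Y).trace -
      frobeniusLoss M Y) ^ 2 + (2 * κ * (ridgeInv ε Y).trace) ^ 2) (matrixNormal M) :=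
    hXT.integrable_sq.add hT.integrable_sq
  have hi2 := hX.integrable_sq
  have hi3 := (integrable_frobeniusLoss_sub_mul M hε).const_mul (4 * κ)
  -- With T = tr R, the left side is (pq - L)² + 4κ(L - pq)T + 8κ²T², and the Laplacian bound times
  -- 4κ pays for 8κ²T². The bracket on the right has mean zero.
  have hle : ∀ Y, ((p : ℝ) * q - 2 * κ * (ridgeInv ε Y).trace - frobeniusLoss M Y) ^ 2 +
      (2 * κ * (ridgeInv ε Y).trace) ^ 2 ≤ ((p : ℝ) * q - frobeniusLoss M Y) ^ 2 +
      4 * κ * ((frobeniusLoss M Y - p * q) * (ridgeInv ε Y).trace -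
        ∑ i, ∑ j, ridgeTraceSecondDeriv ε Y i j) := by
    intro Y
    have h := sum_ridgeTraceSecondDeriv_le hε Y (by simp; omega) (by simp; omega)
    simp only [Fintype.card_fin, ← hκ] at h
    nlinarith [mul_le_mul_of_nonneg_left h hκ0]
  have hint := integral_mono hi1 (hi2.add hi3) hle
  simp only [Pi.add_apply] at hint
  rw [integral_add hi2 hi3, integral_const_mul, integral_frobeniusLoss_sub_mul M hε, mul_zero,
    add_zero] at hint
  rw [← ofReal_integral_eq_lintegral_ofReal hi1 (.of_forall fun Y => by positivity),
    ← ofReal_integral_eq_lintegral_ofReal hi2 (.of_forall fun Y => sq_nonneg _)]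
  exact ENNReal.ofReal_le_ofReal hint

lemma lintegral_sq_sub_frobeniusLoss_ne_top :
    ∫⁻ Y, ENNReal.ofReal (((p : ℝ) * q - frobeniusLoss M Y) ^ 2) ∂(matrixNormal M) ≠ ∞ := by
  have hX : MemLp (fun Y => (p : ℝ) * q - frobeniusLoss M Y) 2 (matrixNormal M) :=
    (memLp_const _).sub (memLp_frobeniusLoss M)
  rw [← ofReal_integral_eq_lintegral_ofReal hX.integrable_sq (.of_forall fun Y => sq_nonneg _)]
  exact ENNReal.ofReal_ne_top

/-- On the singular set tr R ≥ ε⁻¹, so the gain term alone is at least (c/ε)² times its probability;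
the bound is finite and independent of ε, so that probability is 0. -/
lemma ae_isUnit_gram (hq : 1 ≤ q) (hpq : 2 * q + 3 ≤ p) :
    ∀ᵐ Y ∂(matrixNormal M), IsUnit (Yᵀ * Y) := by
  set A := ∫⁻ Y, ENNReal.ofReal (((p : ℝ) * q - frobeniusLoss M Y) ^ 2) ∂(matrixNormal M)
    with hA
  set c : ℝ := 2 * ((p : ℝ) - 2 * q - 2) / q with hc
  have hc0 : 0 < c := by
    have h1 : (2 : ℝ) * q + 3 ≤ p := by exact_mod_cast hpq
    have h2 : (1 : ℝ) ≤ q := by exact_mod_cast hq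
    exact div_pos (by linarith) (by linarith)
  set s : Set (Matrix (Fin p) (Fin q) ℝ) := {Y | ¬ IsUnit (Yᵀ * Y)}
  change matrixNormal M s = 0
  have hbound : ∀ ε : ℝ, 0 < ε → ENNReal.ofReal ((c * ε⁻¹) ^ 2) * matrixNormal M s ≤ A := by
    intro ε hε
    refine le_trans ?_ (lintegral_ridge_le M hq hpq hε)
    have hmeas : Measurable fun Y : Matrix (Fin p) (Fin q) ℝ =>
        ENNReal.ofReal ((c * (ridgeInv ε Y).trace) ^ 2) :=
      (((measurable_trace_ridgeInv ε).const_mul c).pow_const 2).ennreal_ofReal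
    calc ENNReal.ofReal ((c * ε⁻¹) ^ 2) * matrixNormal M s
        ≤ ENNReal.ofReal ((c * ε⁻¹) ^ 2) * matrixNormal M
            {Y | ENNReal.ofReal ((c * ε⁻¹) ^ 2) ≤
              ENNReal.ofReal ((c * (ridgeInv ε Y).trace) ^ 2)} := by
          gcongr
          intro Y hY
          have := inv_le_trace_ridgeInv hε Y hY
          simp only [Set.mem_ofPred_eq]
          gcongr
      _ ≤ ∫⁻ Y, ENNReal.ofReal ((c * (ridgeInv ε Y).trace) ^ 2) ∂(matrixNormal M) :=
          mul_meas_ge_le_lintegral hmeas _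
      _ ≤ _ := lintegral_mono fun Y => le_add_self
  by_contra hs
  obtain ⟨N, hN⟩ := ENNReal.exists_nat_mul_gt hs
    (lintegral_sq_sub_frobeniusLoss_ne_top M)
  -- This ε makes (c/ε)² = (N + 1)² ≥ N.
  have h := hbound (c / (N + 1)) (by positivity)
  refine absurd (hN.trans_le (le_trans ?_ h)) (lt_irrefl _)
  gcongr
  rw [← ENNReal.ofReal_natCast]
  apply ENNReal.ofReal_le_ofReal
  rw [inv_div, mul_div_cancel₀ _ hc0.ne']
  nlinarith [(Nat.cast_nonneg N : (0 : ℝ) ≤ N)]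

lemma measurable_improvedLossEstimator :
    Measurable (improvedLossEstimator (p := p) (q := q)) :=
  ((measurable_matrix_trace (measurable_matrix_inv_apply
    (measurable_gram_apply measurable_matrix_entry))).const_mul _).const_sub _

/-- Fatou's lemma along ε = 1/(N + 1). The gain term is kept on the left because strictness comes
from it. -/
lemma lintegral_improved_add_le (hq : 1 ≤ q) (hpq : 2 * q + 3 ≤ p) :
    ∫⁻ Y, (ENNReal.ofReal ((improvedLossEstimator Y - frobeniusLoss M Y) ^ 2) +
      ENNReal.ofReal ((2 * ((p : ℝ) - 2 * q - 2) / q * ((Yᵀ * Y)⁻¹).trace) ^ 2))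
      ∂(matrixNormal M) ≤
    ∫⁻ Y, ENNReal.ofReal (((p : ℝ) * q - frobeniusLoss M Y) ^ 2) ∂(matrixNormal M) := by
  set c : ℝ := 2 * ((p : ℝ) - 2 * q - 2) / q with hc
  let f : ℕ → Matrix (Fin p) (Fin q) ℝ → ℝ≥0∞ := fun N Y =>
    ENNReal.ofReal (((p : ℝ) * q - c * (ridgeInv (1 / ((N : ℝ) + 1)) Y).trace -
        frobeniusLoss M Y) ^ 2) +
      ENNReal.ofReal ((c * (ridgeInv (1 / ((N : ℝ) + 1)) Y).trace) ^ 2)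
  have hf : ∀ N, Measurable (f N) := fun N =>
    (((((measurable_trace_ridgeInv _).const_mul c).const_sub _).sub
      (measurable_frobeniusLoss M)).pow_const 2).ennreal_ofReal.add
      (((measurable_trace_ridgeInv _).const_mul c).pow_const 2).ennreal_ofReal
  have hlim : ∀ᵐ Y ∂(matrixNormal M),
      ENNReal.ofReal ((improvedLossEstimator Y - frobeniusLoss M Y) ^ 2) +
        ENNReal.ofReal ((c * ((Yᵀ * Y)⁻¹).trace) ^ 2) =
      Filter.liminf (fun N => f N Y) Filter.atTop := by
    filter_upwards [ae_isUnit_gram M hq hpq] with Y hY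
    have ht := ((tendsto_trace_ridgeInv hY).comp
      tendsto_one_div_add_atTop_nhds_zero_nat).const_mul c
    exact (Filter.Tendsto.liminf_eq
      ((ENNReal.tendsto_ofReal (((ht.const_sub _).sub_const _).pow 2)).add
        (ENNReal.tendsto_ofReal (ht.pow 2)))).symm
  rw [lintegral_congr_ae hlim]
  refine (lintegral_liminf_le hf).trans ?_
  refine Filter.liminf_le_of_le (by isBoundedDefault) fun b hb => ?_
  obtain ⟨N, hN⟩ := hb.exists
  exact hN.trans (lintegral_ridge_le M hq hpq (by positivity))

lemma sure_mle (Y : Matrix (Fin p) (Fin q) ℝ) : sure mle Y = (p : ℝ) * q := by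
  simp [sure, mle, lineDeriv]

lemma lossMSE_improved_lt (hq : 1 ≤ q) (hpq : 2 * q + 3 ≤ p) :
    lossMSE matrixNormal frobeniusLoss mle improvedLossEstimator M <
      lossMSE matrixNormal frobeniusLoss mle (sure mle) M := by
  have hle := lintegral_improved_add_le M hq hpq
  have hfin := lintegral_sq_sub_frobeniusLoss_ne_top M
  have hmeas : Measurable fun Y : Matrix (Fin p) (Fin q) ℝ =>
      ENNReal.ofReal ((2 * ((p : ℝ) - 2 * q - 2) / q * ((Yᵀ * Y)⁻¹).trace) ^ 2) :=
    (((measurable_matrix_trace (measurable_matrix_inv_apply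
      (measurable_gram_apply measurable_matrix_entry))).const_mul _).pow_const 2).ennreal_ofReal
  rw [lintegral_add_right _ hmeas] at hle
  simp only [lossMSE, sure_mle]
  change ∫⁻ Y, ENNReal.ofReal ((improvedLossEstimator Y - frobeniusLoss M Y) ^ 2)
    ∂(matrixNormal M) < ∫⁻ Y, ENNReal.ofReal (((p : ℝ) * q - frobeniusLoss M Y) ^ 2)
    ∂(matrixNormal M)
  -- In `ℝ≥0∞` adding the gain is strict only if the risk is finite and the gain nonzero; the latter
  -- holds because T > 0 almost surely.
  refine lt_of_lt_of_le (ENNReal.lt_add_right ?_ ?_) hle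
  · exact ne_top_of_le_ne_top hfin (le_self_add.trans hle)
  · rw [Ne, lintegral_eq_zero_iff hmeas]
    intro h0
    have : ∀ᵐ Y ∂(matrixNormal M), False := by
      filter_upwards [h0, ae_isUnit_gram M hq hpq] with Y hY hu
      have : Nonempty (Fin q) := ⟨⟨0, hq⟩⟩
      have ht := trace_inv_gram_pos hu
      have hc0 : 0 < 2 * ((p : ℝ) - 2 * q - 2) / q := by
        have h1 : (2 : ℝ) * q + 3 ≤ p := by exact_mod_cast hpq
        have h2 : (1 : ℝ) ≤ q := by exact_mod_cast hq
        exact div_pos (by linarith) (by linarith)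
      have h1 := ENNReal.ofReal_eq_zero.1 hY
      have h2 : 0 < (2 * ((p : ℝ) - 2 * q - 2) / q * ((Yᵀ * Y)⁻¹).trace) ^ 2 :=
        pow_pos (mul_pos hc0 ht) 2
      linarith
    exact IsProbabilityMeasure.ne_zero _ (by simpa using this)

end MatrixNormal

end LossEstimation

theorem mainTheorem5 (p q : ℕ) (hq : 1 ≤ q) (hpq : 2 * q + 3 ≤ p) :
    -- SURE of the estimator `M̂(Y) = Y` is the constant `pq`
    (∀ Y : Matrix (Fin p) (Fin q) ℝ, LossEstimation.sure LossEstimation.mle Y = (p : ℝ) * q) ∧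
    -- SURE is inadmissible
    LossEstimation.LossInadmissible (LossEstimation.matrixNormal (p := p) (q := q))
      LossEstimation.frobeniusLoss LossEstimation.mle
      (LossEstimation.sure LossEstimation.mle) ∧
    -- the improved estimator is a genuine loss estimator: measurable, and the inverse in it exists
    -- almost surely
    Measurable (LossEstimation.improvedLossEstimator (p := p) (q := q)) ∧
    (∀ M : Matrix (Fin p) (Fin q) ℝ,
      ∀ᵐ Y ∂(LossEstimation.matrixNormal M), IsUnit (Yᵀ * Y)) ∧
    -- it dominates SURE
    LossEstimation.LossDominates (LossEstimation.matrixNormal (p := p) (q := q))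
      LossEstimation.frobeniusLoss LossEstimation.mle
      LossEstimation.improvedLossEstimator (LossEstimation.sure LossEstimation.mle) ∧
    -- and the improvement is strict at every parameter
    (∀ M : Matrix (Fin p) (Fin q) ℝ,
      LossEstimation.lossMSE LossEstimation.matrixNormal
          LossEstimation.frobeniusLoss LossEstimation.mle
          LossEstimation.improvedLossEstimator M <
        LossEstimation.lossMSE LossEstimation.matrixNormal
          LossEstimation.frobeniusLoss LossEstimation.mle
          (LossEstimation.sure LossEstimation.mle) M) := by
  have hlt := fun M : Matrix (Fin p) (Fin q) ℝ =>
    LossEstimation.lossMSE_improved_lt M hq hpq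
  have hdom : LossEstimation.LossDominates (LossEstimation.matrixNormal (p := p) (q := q))
      LossEstimation.frobeniusLoss LossEstimation.mle
      LossEstimation.improvedLossEstimator (LossEstimation.sure LossEstimation.mle) :=
    ⟨fun M => (hlt M).le, 0, hlt 0⟩
  exact ⟨LossEstimation.sure_mle,
    not_not.2 ⟨_, LossEstimation.measurable_improvedLossEstimator, hdom⟩,
    LossEstimation.measurable_improvedLossEstimator,
    fun M => LossEstimation.ae_isUnit_gram M hq hpq, hdom, hlt⟩
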